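/- Let $n\ge 1$ and $m\ge 1$. There are $n$ rankable objects whose order of arrival is uniformly distributed over all $n!$ permutations. When the $i$-th object arrives, one observes only its relative rank among the first $i$ objects; it is a candidate if it is the best of these. A strategy with $m$ choices selects at most $m$ objects, all of them candidates, and the decision whether to select the $i$-th object depends only on the relative ranks of the first $i$ objects. Consider the following two problems, which have the same set of strategies. (i) The best-choice problem with a random number of objects: only the first $M$ objects are presented, where $M$ is independent of the order of arrival and uniformly distributed on $\{1,\dots,n\}$ (on being presented the $i$-th object one learns about $M$ only that $M\ge i$). One wins if the last object chosen among the presented ones is the best of all $M$ presented objects. The payoff of a strategy is its winning probability. (ii) The scaled duration problem with $n$ objects: all $n$ objects are presented, and the payoff of a strategy is $\frac1n\,\mathbf E\big[\sum_{\tau}(\mathcal T_n(\tau)-\tau)\big]$, where the sum is over the times $\tau$ at which the strategy selects an object, and $\mathcal T_n(\tau)$ is the arrival time of the first candidate after time $\tau$ if there is one, and $n+1$ if there is none. Then the two problems have the same optimal strategies and the same optimal value, and the optimal value is attained in both. Moreover, optimal choices agree in every state: for $1\le i\le n$ and $1\le k\le m$, let $u_i^{(k)}$ (respectively $v_i^{(k)}$)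 be the conditional winning probability in problem (i), given that the $i$-th object is presented and is a candidate, when with $k$ choices remaining one selects (respectively rejects) this object and then continues optimally, and let $w_i^{(k)}=\max\{u_i^{(k)},v_i^{(k)}\}$; let $U_i^{(k)},V_i^{(k)},W_i^{(k)}=\max\{U_i^{(k)},V_i^{(k)}\}$ be the corresponding conditional expected scaled possession times accrued from time $i$ on in problem (ii). Then $w_i^{(k)}=u_i^{(k)}$ if and only if $W_i^{(k)}=U_i^{(k)}$, and $w_i^{(k)}=v_i^{(k)}$ if and only if $W_i^{(k)}=V_i^{(k)}$. -/

import Mathlib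

open MeasureTheory ProbabilityTheory

noncomputable section

namespace ChoiceProblem

/-- Arrival orders of `n` rankable objects. The times are `0, …, n - 1` (one less than in the usual
`1, …, n`), and `ω i` is the absolute rank of the object arriving at time `i`; smaller is
better, so the overall best object is the one with rank `0`. -/
abbrev Order (n : ℕ) : Type := Equiv.Perm (Fin n)

instance (n : ℕ) : MeasurableSpace (Order n) := ⊤

/-- All `n!` arrival orders are equally likely. -/
def orderLaw (n : ℕ) : Measure (Order n) := uniformOn Set.univ

/-- The uniform law on `{1, …, n}`. -/
def uniformLaw (n : ℕ) : Measure ℕ := uniformOn (Set.Icc 1 n)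

/-- The arrival order together with an independent number `M` of objects, uniform on
`{1, …, n}`: only the objects with (zero-based) arrival time less than `M` are presented. -/
def randomNumberLaw (n : ℕ) : Measure (Order n × ℕ) := (orderLaw n).prod (uniformLaw n)

/-- The relative rank of the `i`-th object among those that arrived up to time `i`. -/
def relRank {n : ℕ} (ω : Order n) (i : Fin n) : ℕ :=
  (Finset.univ.filter (fun j : Fin n => j ≤ i ∧ ω j ≤ ω i)).card

/-- A candidate is a relatively best object. -/
def IsCandidate {n : ℕ} (ω : Order n) (i : Fin n) : Prop := relRank ω i = 1

/-- A strategy with at most `k` choices. `chosen ω` is the set of times at which an object would be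
selected if all `n` objects were presented. Whether the `i`-th object is selected depends only on
the relative ranks observed up to time `i`, and only candidates are selected. (The
increasing enumeration of `chosen` is the vector of stopping times.) In the problem with a
random number `M` of objects, the selections actually made are those at times less than
`M`; on being presented the `i`-th object one knows only its relative rank, the earlier relative
ranks, and that it was presented. -/
structure Strategy (n k : ℕ) where
  chosen : Order n → Finset (Fin n)
  nonanticipating : ∀ (ω ω' : Order n) (i : Fin n),
    (∀ j ≤ i, relRank ω j = relRank ω' j) → (i ∈ chosen ω ↔ i ∈ chosen ω')
  candidate : ∀ (ω : Order n), ∀ i ∈ chosen ω, IsCandidate ω i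
  card_le : ∀ ω : Order n, (chosen ω).card ≤ k

/-! ### The best-choice problem with a uniformly distributed number of objects -/

/-- The strategy wins if at least one presented object is chosen and the last chosen one among them
is the best of all presented objects. -/
def Wins {n k : ℕ} (σ : Strategy n k) (ω : Order n) (M : ℕ) : Prop :=
  ∃ j ∈ σ.chosen ω, (j : ℕ) < M ∧
    (∀ l ∈ σ.chosen ω, (l : ℕ) < M → l ≤ j) ∧
    ∀ l : Fin n, (l : ℕ) < M → ω j ≤ ω l

/-- The winning probability of a strategy. -/
def winProb {n k : ℕ} (σ : Strategy n k) : ℝ :=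
  (randomNumberLaw n).real {p | Wins σ p.1 p.2}

/-- The winning probability of a strategy, given that the `i`-th object is presented and is a
candidate. -/
def winProbAt {n k : ℕ} (i : Fin n) (σ : Strategy n k) : ℝ :=
  (cond (randomNumberLaw n) {p | IsCandidate p.1 i ∧ (i : ℕ) < p.2}).real {p | Wins σ p.1 p.2}

/-! ### The duration problem with a fixed number of objects -/

/-- The arrival time of the first candidate after time `i`, and `n` if there is none (`n` is
the first time, counted from zero, after the last arrival). -/
def nextCandidate {n : ℕ} (ω : Order n) (i : Fin n) : ℕ :=
  sInf {t : ℕ | (i : ℕ) < t ∧ (t = n ∨ ∃ h : t < n, IsCandidate ω ⟨t, h⟩)}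

/-- The time for which a candidate selected at time `i` remains a candidate. -/
def duration {n : ℕ} (ω : Order n) (i : Fin n) : ℝ := (nextCandidate ω i : ℝ) - ((i : ℕ) : ℝ)

/-- The total possession time, divided by `n`. -/
def scaledPossession {n k : ℕ} (σ : Strategy n k) (ω : Order n) : ℝ :=
  ∑ i ∈ σ.chosen ω, duration ω i / (n : ℝ)

/-- The expected scaled total possession time of a strategy. -/
def expPossession {n k : ℕ} (σ : Strategy n k) : ℝ :=
  ∫ ω, scaledPossession σ ω ∂(orderLaw n)

/-- The expected scaled total possession time of a strategy, given that the `i`-th object is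
a candidate. -/
def expPossessionAt {n k : ℕ} (i : Fin n) (σ : Strategy n k) : ℝ :=
  ∫ ω, scaledPossession σ ω ∂(cond (orderLaw n) {ω | IsCandidate ω i})

/-! ### Optimality, and the decision in a given state -/

/-- `σ` is optimal for the expected payoff `payoff`. -/
def IsOptimal {n k : ℕ} (payoff : Strategy n k → ℝ) (σ : Strategy n k) : Prop :=
  ∀ σ' : Strategy n k, payoff σ' ≤ payoff σ

/-- The strategies with `k` choices that select the `i`-th object, if it is a candidate, and
make no earlier choice. -/
def selecting {n : ℕ} (i : Fin n) (k : ℕ) : Set (Strategy n k) :=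
  {σ | (∀ ω, ∀ j ∈ σ.chosen ω, i ≤ j) ∧ ∀ ω, IsCandidate ω i → i ∈ σ.chosen ω}

/-- The strategies with `k` choices that reject the `i`-th object and make no earlier choice. -/
def rejecting {n : ℕ} (i : Fin n) (k : ℕ) : Set (Strategy n k) :=
  {σ | ∀ ω, ∀ j ∈ σ.chosen ω, i < j}

/-- The winning probability from the state `(i, k)` (the `i`-th object is a candidate and `k`
choices remain) when the `i`-th object is selected and one then continues optimally. -/
def winSelect {n : ℕ} (i : Fin n) (k : ℕ) : ℝ := sSup (winProbAt i '' selecting i k)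

/-- The winning probability from the state `(i, k)` when the `i`-th object is rejected and one then
continues optimally. -/
def winReject {n : ℕ} (i : Fin n) (k : ℕ) : ℝ := sSup (winProbAt i '' rejecting i k)

/-- The optimal winning probability from the state `(i, k)`. -/
def winValue {n : ℕ} (i : Fin n) (k : ℕ) : ℝ := max (winSelect i k) (winReject i k)

/-- The expected scaled possession time from the state `(i, k)` when the `i`-th object is selected
and one then continues optimally. -/
def possessionSelect {n : ℕ} (i : Fin n) (k : ℕ) : ℝ :=
  sSup (expPossessionAt i '' selecting i k)

/-- The expected scaled possession time from the state `(i, k)` when the `i`-th object is rejected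
and one then continues optimally. -/
def possessionReject {n : ℕ} (i : Fin n) (k : ℕ) : ℝ :=
  sSup (expPossessionAt i '' rejecting i k)

/-- The optimal expected scaled possession time from the state `(i, k)`. -/
def possessionValue {n : ℕ} (i : Fin n) (k : ℕ) : ℝ :=
  max (possessionSelect i k) (possessionReject i k)

end ChoiceProblem

end

/-!
Count times from zero and fix the arrival order. A candidate at time `j` is the best of the first
`M` objects exactly when `j < M ≤ T(j)`, where `T(j)` is the time of the next candidate. The
intervals `(j, T(j)]` of the chosen candidates are pairwise disjoint, and a strategy wins if and
only if `M` lies in one of them. Averaging over a uniform `M` therefore turns the winning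
probability into the scaled possession time, strategy by strategy. Given that the object at time `i`
is presented, `M` is uniform on `(i, n]` instead of `(0, n]`, so the payoffs in a state at time `i`
differ by the factor `n / (n - i)`, which does not affect which decision is better.
-/

section UniformAndProduct

variable {α β : Type*} [MeasurableSpace α] [MeasurableSpace β]

theorem uniformOn_real_eq_card_div [MeasurableSingletonClass α] {s t : Finset α} {u : Set α}
    (h : (s : Set α) ∩ u = t) : (uniformOn (s : Set α)).real u = (t.card : ℝ) / s.card := by
  classical
  have hts : t ⊆ s := Finset.coe_subset.1 (h ▸ Set.inter_subset_left)
  rw [measureReal_def, ← uniformOn_inter_self s.finite_toSet, h, uniformOn_apply_finset,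
    Finset.inter_eq_right.2 hts, ENNReal.toReal_div, ENNReal.toReal_natCast, ENNReal.toReal_natCast]

theorem cond_uniformOn [MeasurableSingletonClass α] {s t : Set α} (hs : s.Finite)
    (ht : MeasurableSet t) : (uniformOn s)[|t] = uniformOn (s ∩ t) :=
  cond_cond_eq_cond_inter' hs.measurableSet ht (Measure.count_apply_lt_top.2 hs).ne

theorem cond_prod_eq_prod_cond (μ : Measure α) (ν : Measure β) [IsFiniteMeasure μ]
    [IsFiniteMeasure ν] (s : Set α) (t : Set β) :
    (μ.prod ν)[|s ×ˢ t] = (μ[|s]).prod (ν[|t]) := by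
  simp only [ProbabilityTheory.cond, Measure.prod_smul_left, Measure.prod_smul_right,
    Measure.prod_restrict, Measure.prod_prod, smul_smul]
  rw [ENNReal.mul_inv (.inr (measure_ne_top ν t)) (.inl (measure_ne_top μ s)), mul_comm]

theorem prod_real_apply_eq_integral (μ : Measure α) (ν : Measure β) [IsFiniteMeasure ν]
    {s : Set (α × β)} (hs : MeasurableSet s) :
    (μ.prod ν).real s = ∫ a, ν.real (Prod.mk a ⁻¹' s) ∂μ := by
  simp only [measureReal_def, Measure.prod_apply hs]
  exact (integral_toReal (measurable_measure_prodMk_left hs).aemeasurable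
    (.of_forall fun _ => measure_lt_top _ _)).symm

end UniformAndProduct

namespace ChoiceProblem

variable {n k : ℕ}

theorem isCandidate_iff {ω : Order n} {i : Fin n} : IsCandidate ω i ↔ ∀ j ≤ i, ω i ≤ ω j := by
  have hi : i ∈ Finset.univ.filter fun j => j ≤ i ∧ ω j ≤ ω i := by simp
  constructor
  · intro h j hj
    by_contra! hlt
    have hji : j = i := Finset.card_le_one.1 (le_of_eq h) j (by simp [hj, hlt.le]) i hi
    exact hlt.ne (congrArg ω hji)
  · intro h
    refine Finset.card_eq_one.2 ⟨i, Finset.eq_singleton_iff_unique_mem.2 ⟨hi, fun j hj => ?_⟩⟩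
    obtain ⟨hji, hle⟩ := (Finset.mem_filter.1 hj).2
    exact ω.injective (hle.antisymm (h j hji))

theorem exists_isCandidate_le (ω : Order n) (l : Fin n) :
    ∃ a ≤ l, IsCandidate ω a ∧ ω a ≤ ω l := by
  obtain ⟨a, ha, hmin⟩ := Finset.exists_min_image (Finset.Iic l) ω Finset.nonempty_Iic
  rw [Finset.mem_Iic] at ha
  exact ⟨a, ha, isCandidate_iff.2 fun j hj => hmin j (Finset.mem_Iic.2 (hj.trans ha)),
    hmin l (Finset.mem_Iic.2 le_rfl)⟩

theorem nextCandidate_spec (ω : Order n) (i : Fin n) :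
    (i : ℕ) < nextCandidate ω i ∧ (nextCandidate ω i = n ∨
      ∃ h : nextCandidate ω i < n, IsCandidate ω ⟨nextCandidate ω i, h⟩) :=
  Nat.sInf_mem (s := {t : ℕ | (i : ℕ) < t ∧ (t = n ∨ ∃ h : t < n, IsCandidate ω ⟨t, h⟩)})
    ⟨n, i.isLt, Or.inl rfl⟩

theorem lt_nextCandidate (ω : Order n) (i : Fin n) : (i : ℕ) < nextCandidate ω i :=
  (nextCandidate_spec ω i).1

theorem nextCandidate_le (ω : Order n) (i : Fin n) : nextCandidate ω i ≤ n :=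
  Nat.sInf_le ⟨i.isLt, Or.inl rfl⟩

theorem nextCandidate_le_of_isCandidate {ω : Order n} {i j : Fin n} (hij : i < j)
    (hj : IsCandidate ω j) : nextCandidate ω i ≤ j :=
  Nat.sInf_le ⟨hij, Or.inr ⟨j.isLt, hj⟩⟩

/-- The possession interval `(j, T(j)]` of a candidate `j`: the numbers `M` of presented objects for
which `j` is the last candidate presented. With times counted from zero, `M` objects are those at
times less than `M`, hence the half-open interval. -/
noncomputable def possessionInterval (ω : Order n) (j : Fin n) : Finset ℕ :=
  Finset.Ioc (j : ℕ) (nextCandidate ω j)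

theorem card_possessionInterval (ω : Order n) (j : Fin n) :
    ((possessionInterval ω j).card : ℝ) = duration ω j := by
  rw [possessionInterval, Nat.card_Ioc, Nat.cast_sub (lt_nextCandidate ω j).le, duration]

theorem disjoint_possessionInterval {ω : Order n} {i j : Fin n} (hij : i < j)
    (hj : IsCandidate ω j) : Disjoint (possessionInterval ω i) (possessionInterval ω j) := by
  have hle := nextCandidate_le_of_isCandidate hij hj
  simp only [possessionInterval, Finset.disjoint_left, Finset.mem_Ioc]
  omega

theorem pairwiseDisjoint_possessionInterval (ω : Order n) :
    {j | IsCandidate ω j}.PairwiseDisjoint (possessionInterval ω) := by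
  intro i hi j hj hij
  rcases lt_or_gt_of_ne hij with h | h
  · exact disjoint_possessionInterval h hj
  · exact (disjoint_possessionInterval h hi).symm

theorem mem_possessionInterval_iff {ω : Order n} {j : Fin n} (hj : IsCandidate ω j) {M : ℕ}
    (hM : M ≤ n) :
    M ∈ possessionInterval ω j ↔ (j : ℕ) < M ∧ ∀ l : Fin n, (l : ℕ) < M → ω j ≤ ω l := by
  rw [possessionInterval, Finset.mem_Ioc]
  refine and_congr_right fun _ => ⟨fun hle l hl => ?_, fun hbest => ?_⟩
  · obtain ⟨a, hal, ha, hωa⟩ := exists_isCandidate_le ω l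
    have haj : a ≤ j := by
      by_contra! hja
      exact absurd (nextCandidate_le_of_isCandidate hja ha) (by omega)
    exact (isCandidate_iff.1 hj a haj).trans hωa
  · by_contra! hlt
    obtain ⟨hjt, heq | ⟨hn, ht⟩⟩ := nextCandidate_spec ω j
    · omega
    · have hωt := isCandidate_iff.1 ht j (Fin.le_def.2 hjt.le)
      have hjt' : j = ⟨nextCandidate ω j, hn⟩ := ω.injective ((hbest _ hlt).antisymm hωt)
      exact hjt.ne (congrArg Fin.val hjt')

namespace Strategy

theorem chosen_injective : Function.Injective (chosen : Strategy n k → Order n → Finset (Fin n)) :=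
  fun ⟨_, _, _, _⟩ ⟨_, _, _, _⟩ h => by cases h; rfl

instance : Finite (Strategy n k) := Finite.of_injective chosen chosen_injective

instance : Nonempty (Strategy n k) :=
  ⟨{ chosen := fun _ => ∅
     nonanticipating := by simp
     candidate := by simp
     card_le := by simp }⟩

/-- The numbers `M ≤ n` of presented objects for which the strategy wins on the arrival order `ω`,
as the union of the possession intervals of the chosen candidates. -/
noncomputable def winningNumbers (σ : Strategy n k) (ω : Order n) : Finset ℕ :=
  (σ.chosen ω).biUnion (possessionInterval ω)

theorem card_winningNumbers (σ : Strategy n k) (ω : Order n) :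
    ((σ.winningNumbers ω).card : ℝ) = ∑ j ∈ σ.chosen ω, duration ω j := by
  rw [winningNumbers, Finset.card_biUnion, Nat.cast_sum]
  · exact Finset.sum_congr rfl fun j _ => card_possessionInterval ω j
  · exact (pairwiseDisjoint_possessionInterval ω).subset (σ.candidate ω)

theorem winningNumbers_subset_Ioc (σ : Strategy n k) (ω : Order n) {i : ℕ}
    (hi : ∀ j ∈ σ.chosen ω, i ≤ (j : ℕ)) : σ.winningNumbers ω ⊆ Finset.Ioc i n :=
  Finset.biUnion_subset.2 fun j hj => Finset.Ioc_subset_Ioc (hi j hj) (nextCandidate_le ω j)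

end Strategy

theorem wins_iff_mem_winningNumbers (σ : Strategy n k) (ω : Order n) {M : ℕ} (hM : M ≤ n) :
    Wins σ ω M ↔ M ∈ σ.winningNumbers ω := by
  rw [Strategy.winningNumbers, Finset.mem_biUnion]
  refine exists_congr fun j => and_congr_right fun hj => ?_
  rw [mem_possessionInterval_iff (σ.candidate ω j hj) hM]
  refine and_congr_right fun _ => and_iff_right_of_imp fun hbest l hl hlM => ?_
  by_contra! hjl
  have hωl : ω l ≤ ω j := isCandidate_iff.1 (σ.candidate ω l hl) j hjl.le
  exact hjl.ne (ω.injective ((hbest l hlM).antisymm hωl))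

theorem uniformOn_Ioc_real_wins (σ : Strategy n k) (ω : Order n) {i : ℕ} (hin : i ≤ n)
    (hi : ∀ j ∈ σ.chosen ω, i ≤ (j : ℕ)) :
    (uniformOn (Set.Ioc i n)).real {M | Wins σ ω M} =
      (∑ j ∈ σ.chosen ω, duration ω j) / ((n : ℝ) - i) := by
  have hwins : (Finset.Ioc i n : Set ℕ) ∩ {M | Wins σ ω M} = σ.winningNumbers ω := by
    ext M
    simp only [Set.mem_inter_iff, Finset.mem_coe, Set.mem_ofPred_eq]
    constructor
    · rintro ⟨hM, hw⟩
      exact (wins_iff_mem_winningNumbers σ ω (Finset.mem_Ioc.1 hM).2).1 hw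
    · intro hw
      have hM := σ.winningNumbers_subset_Ioc ω hi hw
      exact ⟨hM, (wins_iff_mem_winningNumbers σ ω (Finset.mem_Ioc.1 hM).2).2 hw⟩
  rw [← Finset.coe_Ioc, uniformOn_real_eq_card_div hwins, σ.card_winningNumbers, Nat.card_Ioc,
    Nat.cast_sub hin]

theorem uniformLaw_eq_uniformOn_Ioc (n : ℕ) : uniformLaw n = uniformOn (Set.Ioc 0 n) := rfl

theorem cond_uniformLaw_lt (n i : ℕ) :
    (uniformLaw n)[|{M | i < M}] = uniformOn (Set.Ioc i n) := by
  rw [uniformLaw, cond_uniformOn (Set.finite_Icc 1 n) .of_discrete]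
  congr 1
  ext M
  simp only [Set.mem_inter_iff, Set.mem_Icc, Set.mem_ofPred_eq, Set.mem_Ioc]
  omega

theorem uniformLaw_real_wins (σ : Strategy n k) (ω : Order n) :
    (uniformLaw n).real {M | Wins σ ω M} = scaledPossession σ ω := by
  rw [uniformLaw_eq_uniformOn_Ioc, uniformOn_Ioc_real_wins σ ω n.zero_le fun _ _ => Nat.zero_le _,
    Nat.cast_zero, sub_zero, scaledPossession, Finset.sum_div]

/-- The ratio of the payoffs of the two problems in a state at time `i`: the reciprocal of the
probability `(n - i) / n` that the object arriving at time `i`, counted from zero, is presented. -/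
noncomputable def payoffRatio (i : Fin n) : ℝ := n / ((n : ℝ) - (i : ℕ))

theorem payoffRatio_pos (i : Fin n) : 0 < payoffRatio i :=
  div_pos (Nat.cast_pos.2 i.pos) (sub_pos.2 (Nat.cast_lt.2 i.isLt))

theorem cond_uniformLaw_real_wins (i : Fin n) (σ : Strategy n k) (ω : Order n)
    (hσ : ∀ j ∈ σ.chosen ω, i ≤ j) :
    ((uniformLaw n)[|{M | (i : ℕ) < M}]).real {M | Wins σ ω M} =
      payoffRatio i * scaledPossession σ ω := by
  have hn : (n : ℝ) ≠ 0 := Nat.cast_ne_zero.2 i.pos.ne'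
  rw [cond_uniformLaw_lt, uniformOn_Ioc_real_wins σ ω i.isLt.le hσ, scaledPossession,
    ← Finset.sum_div, payoffRatio]
  field_simp

instance (n : ℕ) : IsProbabilityMeasure (orderLaw n) :=
  instIsProbabilityMeasure_uniformOn_univ

instance (n : ℕ) : IsFiniteMeasure (uniformLaw n) := by
  unfold uniformLaw uniformOn
  infer_instance

theorem winProb_eq_expPossession (σ : Strategy n k) : winProb σ = expPossession σ := by
  rw [winProb, expPossession, randomNumberLaw, prod_real_apply_eq_integral _ _ .of_discrete]
  exact integral_congr_ae (.of_forall (uniformLaw_real_wins σ))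

theorem winProbAt_eq_mul_expPossessionAt (i : Fin n) (σ : Strategy n k)
    (hσ : ∀ ω, ∀ j ∈ σ.chosen ω, i ≤ j) :
    winProbAt i σ = payoffRatio i * expPossessionAt i σ := by
  have hprod : {p : Order n × ℕ | IsCandidate p.1 i ∧ (i : ℕ) < p.2} =
      {ω | IsCandidate ω i} ×ˢ {M | (i : ℕ) < M} := rfl
  rw [winProbAt, expPossessionAt, randomNumberLaw, hprod, cond_prod_eq_prod_cond,
    prod_real_apply_eq_integral _ _ .of_discrete, ← integral_const_mul]
  exact integral_congr_ae (.of_forall fun ω => cond_uniformLaw_real_wins i σ ω (hσ ω))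

theorem sSup_winProbAt_image (i : Fin n) {S : Set (Strategy n k)}
    (hS : ∀ σ ∈ S, ∀ ω, ∀ j ∈ σ.chosen ω, i ≤ j) :
    sSup (winProbAt i '' S) = payoffRatio i * sSup (expPossessionAt i '' S) := by
  rw [← smul_eq_mul, ← Real.sSup_smul_of_nonneg (payoffRatio_pos i).le, ← Set.image_smul,
    Set.image_image]
  exact congrArg sSup
    (Set.image_congr fun σ hσ => winProbAt_eq_mul_expPossessionAt i σ (hS σ hσ))

theorem winSelect_eq_mul_possessionSelect (i : Fin n) (k : ℕ) :
    winSelect i k = payoffRatio i * possessionSelect i k :=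
  sSup_winProbAt_image i fun _ hσ => hσ.1

theorem winReject_eq_mul_possessionReject (i : Fin n) (k : ℕ) :
    winReject i k = payoffRatio i * possessionReject i k :=
  sSup_winProbAt_image i fun _ hσ ω j hj => (hσ ω j hj).le

theorem winValue_eq_mul_possessionValue (i : Fin n) (k : ℕ) :
    winValue i k = payoffRatio i * possessionValue i k := by
  rw [winValue, possessionValue, winSelect_eq_mul_possessionSelect,
    winReject_eq_mul_possessionReject, mul_max_of_nonneg _ _ (payoffRatio_pos i).le]

theorem winValue_eq_winSelect_iff (i : Fin n) (k : ℕ) :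
    winValue i k = winSelect i k ↔ possessionValue i k = possessionSelect i k := by
  rw [winValue_eq_mul_possessionValue, winSelect_eq_mul_possessionSelect,
    mul_right_inj' (payoffRatio_pos i).ne']

theorem winValue_eq_winReject_iff (i : Fin n) (k : ℕ) :
    winValue i k = winReject i k ↔ possessionValue i k = possessionReject i k := by
  rw [winValue_eq_mul_possessionValue, winReject_eq_mul_possessionReject,
    mul_right_inj' (payoffRatio_pos i).ne']

end ChoiceProblem

theorem theorem3 (n m : ℕ) (hn : 1 ≤ n) (hm : 1 ≤ m) :
    -- the same strategies are optimal in the two problems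
    (∀ σ : ChoiceProblem.Strategy n m,
      ChoiceProblem.IsOptimal ChoiceProblem.winProb σ ↔
        ChoiceProblem.IsOptimal ChoiceProblem.expPossession σ) ∧
    -- both optimal values are attained, and they are equal
    (∃ v : ℝ,
      IsGreatest (Set.range (ChoiceProblem.winProb : ChoiceProblem.Strategy n m → ℝ)) v ∧
      IsGreatest (Set.range (ChoiceProblem.expPossession : ChoiceProblem.Strategy n m → ℝ)) v) ∧
    -- in every state, selecting (rejecting) is optimal in one problem iff it is in the other
    (∀ (i : Fin n) (k : ℕ), 1 ≤ k → k ≤ m →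
      (ChoiceProblem.winValue i k = ChoiceProblem.winSelect i k ↔
        ChoiceProblem.possessionValue i k = ChoiceProblem.possessionSelect i k) ∧
      (ChoiceProblem.winValue i k = ChoiceProblem.winReject i k ↔
        ChoiceProblem.possessionValue i k = ChoiceProblem.possessionReject i k)) := by
  have hpayoff : (ChoiceProblem.winProb : ChoiceProblem.Strategy n m → ℝ) =
      ChoiceProblem.expPossession := funext ChoiceProblem.winProb_eq_expPossession
  obtain ⟨v, hv⟩ := (Set.finite_range
    (ChoiceProblem.expPossession : ChoiceProblem.Strategy n m → ℝ)).isCompact.exists_isGreatest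
      (Set.range_nonempty _)
  rw [hpayoff]
  exact ⟨fun _ => Iff.rfl, ⟨v, hv, hv⟩, fun i k _ _ =>
    ⟨ChoiceProblem.winValue_eq_winSelect_iff i k, ChoiceProblem.winValue_eq_winReject_iff i k⟩⟩
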